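/- All rings are commutative with $1$. A *groupoid* $G$ is regarded as its nonempty set of arrows; each $g\in G$ has identities $d(g)=g^{-1}g$ and $r(g)=gg^{-1}$, the product $gh$ is defined if and only if $d(g)=r(h)$, and $G_0$ is the set of identities. A *wide subgroupoid* of $G$ is a subset $H\supseteq G_0$ closed under inverses and under all defined products. Let $G$ be a finite groupoid, $K\neq 0$ a ring and $R$ a faithful $K$-algebra. Let $\beta=\{\beta_g:E_{g^{-1}}\to E_g\}_{g\in G}$ be an action of $G$ on $R$: each $E_g=E_{r(g)}$ is an ideal of $R$, each $\beta_g$ is a bijective, $K$-linear and multiplicative map, $\beta_e=\mathrm{id}_{E_e}$ for $e\in G_0$, and $\beta_g\beta_h=\beta_{gh}$ on $E_{h^{-1}}$ whenever $gh$ is defined. Assume that each $E_e$ ($e\in G_0$) has an identity element $1_e$, and put $1_g=1_{r(g)}$. Assume also that $R=\bigoplus_{e\in G_0}E_e$. For a wide subgroupoid $H$ put $$R^{\beta_H}=\{r\in R \mid \beta_h(rx)=r\beta_h(x)\ \text{for all } h\in H,\ x\in E_{h^{-1}}\},$$ and assume that $R^{\beta}:=R^{\beta_G}=K$ (that is, it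 is the image of $K$ in $R$). Suppose that $R$ is a $\beta$-Galois extension of $K$, i.e. there are $m\ge 0$ and $r_i,s_i\in R$ ($1\le i\le m$) such that $\sum_{i}r_i\beta_g(s_i1_{g^{-1}})$ equals $1_g$ if $g\in G_0$ and $0$ if $g\in G\setminus G_0$. Suppose that each $E_g$ ($g\in G$) is a faithful, projective and finitely generated $K$-module. For a $K$-subalgebra $T$ of $R$ let $H_T=\{g\in G\mid \beta_g(t1_{g^{-1}})=t1_g \text{ for all } t\in T\}$. Call $T$ *$\beta$-strong* if for all $g,h\in G$ with $r(g)=r(h)$ and $g^{-1}h\notin H_T$, and for every nonzero idempotent $\epsilon\in E_g=E_h$, there is $t\in T$ with $\beta_g(t1_{g^{-1}})\epsilon\neq\beta_h(t1_{h^{-1}})\epsilon$. Call $T$ *separable* over $K$ if $T$ is a projective $T\otimes_K T$-module (via multiplication). **Theorem (The Galois correspondence).** The map $H\mapsto R^{\beta_H}$ is a bijection from the set of all wide subgroupoids of $G$ onto the set of all $K$-subalgebras of $R$ that are separable over $K$ and $\beta$-strong. -/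

import Mathlib

open CategoryTheory
open scoped TensorProduct

universe u v

/-- An action of a groupoid on a commutative `K`-algebra `R` by unital ideals.

Elements of the groupoid are the arrows of `C`; an arrow `g : x ⟶ y` has domain identity
`d(g) = 𝟙 x` and range identity `r(g) = 𝟙 y`, and the groupoid product `g h`, defined if and only
if `d(g) = r(h)`, is the categorical composite `h ≫ g`.  As `E_g = E_{r(g)}`, the ideals are
indexed by the objects: for `g : x ⟶ y` one has `E_g = E y`, `E_{g⁻¹} = E x`, and
`β_g : E x → E y` is an isomorphism of (not necessarily unital sub-) `K`-algebras. -/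
structure GroupoidAction (C : Type u) [Groupoid.{v} C] (K R : Type*) [CommRing K] [CommRing R]
    [Algebra K R] where
  /-- the ideals `E_e`, for `e` an identity of the groupoid -/
  E : C → Ideal R
  /-- the isomorphisms `β_g : E_{g⁻¹} → E_g` -/
  β : ∀ {x y : C}, (x ⟶ y) → (E x ≃ₗ[K] E y)
  /-- each `β_g` is multiplicative -/
  β_mul : ∀ {x y : C} (g : x ⟶ y) (a b : E x), β g (a * b) = β g a * β g b
  /-- identities act as identity maps -/
  β_id : ∀ (x : C) (a : E x), β (𝟙 x) a = a
  /-- `β_g (β_h a) = β_{gh} a` whenever the product `gh` is defined -/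
  β_comp : ∀ {x y z : C} (h : x ⟶ y) (g : y ⟶ z) (a : E x), β g (β h a) = β (h ≫ g) a
  /-- the identity element `1_e` of the ideal `E_e` -/
  unit : ∀ x : C, E x
  /-- `1_e` is an identity element of `E_e` -/
  unit_mul : ∀ (x : C) (a : E x), unit x * a = a

namespace GroupoidAction

variable {C : Type u} [Groupoid.{v} C] {K R : Type*} [CommRing K] [CommRing R] [Algebra K R]

/-- For `g : x ⟶ y` (so that `1_{g⁻¹} = 1_x`), the element `β_g (r 1_{g⁻¹})` of `R`. -/
def app (A : GroupoidAction C K R) {x y : C} (g : x ⟶ y) (r : R) : R :=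
  (A.β g (r • A.unit x) : R)

/-- The subalgebra `R^{β_H}` of invariants of the restriction `β_H = (β_h)_{h ∈ H}` of the action
to a subgroupoid `H`: those `r` with `β_h (r a) = r β_h (a)` for all `h ∈ H` and `a ∈ E_{h⁻¹}`. -/
def invariants (A : GroupoidAction C K R) (H : Subgroupoid C) : Subalgebra K R where
  carrier := {r | ∀ (x y : C) (h : x ⟶ y), h ∈ H.arrows x y →
    ∀ a : A.E x, A.β h (r • a) = r • A.β h a}
  mul_mem' := by
    intro r s hr hs x y h hh a
    rw [mul_smul, hr x y h hh, hs x y h hh, mul_smul]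
  add_mem' := by
    intro r s hr hs x y h hh a
    rw [add_smul, map_add, hr x y h hh, hs x y h hh, add_smul]
  algebraMap_mem' := by
    intro k x y h hh a
    rw [algebraMap_smul, algebraMap_smul, map_smul]

/-- `R` is a `β`-Galois extension of `R^β`: there are `r_i, s_i ∈ R` (`1 ≤ i ≤ m`) such that
`∑ r_i β_g (s_i 1_{g⁻¹})` is `1_e` if `g` is an identity `e` of the groupoid, and is `0` if `g` is
not an identity. -/
def IsGalois (A : GroupoidAction C K R) : Prop :=
  ∃ (m : ℕ) (r s : Fin m → R),
    (∀ x : C, ∑ i, r i * A.app (𝟙 x) (s i) = A.unit x) ∧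
    (∀ (x : C) (g : x ⟶ x), g ≠ 𝟙 x → ∑ i, r i * A.app g (s i) = 0) ∧
    (∀ (x y : C) (g : x ⟶ y), x ≠ y → ∑ i, r i * A.app g (s i) = 0)

/-- The set `H_T` of all `g` in the groupoid such that `β_g (t 1_{g⁻¹}) = t 1_g` for all
`t ∈ T`, given by its arrows from `x` to `y`. -/
def fixingArrows (A : GroupoidAction C K R) (T : Subalgebra K R) (x y : C) : Set (x ⟶ y) :=
  {g | ∀ t ∈ T, A.app g t = t * A.unit y}

/-- `T` is `β`-strong: for all `g, h` with `r(g) = r(h)` and `g⁻¹ h ∉ H_T` and every nonzero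
idempotent `e` of `E_g = E_h` there is `t ∈ T` with `β_g (t 1_{g⁻¹}) e ≠ β_h (t 1_{h⁻¹}) e`. -/
def IsStrong (A : GroupoidAction C K R) (T : Subalgebra K R) : Prop :=
  ∀ (x y z : C) (g : x ⟶ z) (h : y ⟶ z), h ≫ Groupoid.inv g ∉ A.fixingArrows T y x →
    ∀ e ∈ A.E z, IsIdempotentElem e → e ≠ 0 → ∃ t ∈ T, A.app g t * e ≠ A.app h t * e

end GroupoidAction

/-- A commutative `K`-algebra `T` is separable if `T` is a projective `T ⊗ T`-module, where
`T ⊗ T` acts on `T` through the multiplication map, `(a ⊗ b) • t = a b t`. -/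
def IsSeparableAlgebra (K T : Type*) [CommRing K] [CommRing T] [Algebra K T] : Prop :=
  letI : Module (T ⊗[K] T) T := Module.compHom T (Algebra.TensorProduct.lmul' K (S := T)).toRingHom
  Module.Projective (T ⊗[K] T) T

/-- A `K`-module is faithfully projective if it is faithful, projective and finitely generated. -/
def IsFaithfullyProjective (K M : Type*) [CommRing K] [AddCommGroup M] [Module K M] : Prop :=
  FaithfulSMul K M ∧ Module.Projective K M ∧ Module.Finite K M

namespace GroupoidAction

/-! Everything rests on the trace along a wide `H`. Galois coordinates `r i`, `s i` make `R` finite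
over `R^H` with dual basis `tr_H (s i * ·)`, `r i`, and Nakayama then yields `c` with `tr_H c = 1`
(`exists_trace_eq_one`). The elements `tr_H (c * r i)` and `tr_H (s i)` of `R^H` are coordinates
relative to `H`: `∑ a i * β_g (b i)` is `1_g` on `H` and `0` off it (`sum_trace_mul_app_trace`).
They show that `R^H` is strong and that its fixing arrows are exactly `H`, which gives injectivity;
`∑ a i ⊗ b i` is a separability element. For surjectivity, take `T` separable and strong with
separability idempotent `e`. Its pairing with `g` is `1_g` on `H_T`, and strongness kills it
elsewhere. Weighting these pairings by `u * c` and summing returns any `u` fixed by `H_T`, while the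
same sum lies in `T` because full traces lie in `K`. -/

open scoped Classical in
/-- The trace `∑_{h ∈ H} β_h (r 1_{h⁻¹})` of `r` along a subgroupoid `H`. -/
noncomputable def trace {C : Type u} [Groupoid.{v} C] {K R : Type*} [CommRing K] [CommRing R]
    [Algebra K R] [Fintype C] [∀ x y : C, Fintype (x ⟶ y)] (A : GroupoidAction C K R)
    (H : Subgroupoid C) : R → R := fun r =>
  ∑ x : C, ∑ y : C, ∑ h : x ⟶ y, if h ∈ H.arrows x y then A.app h r else 0

/-! ### Formal properties of the action, the pairings and the fixing subgroupoid. -/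

section Basic

variable {C : Type u} [Groupoid.{v} C] {K R : Type*} [CommRing K] [CommRing R] [Algebra K R]
  (A : GroupoidAction C K R)

lemma unit_mul_of_mem {x : C} {a : R} (ha : a ∈ A.E x) : (A.unit x : R) * a = a :=
  congrArg Subtype.val (A.unit_mul x ⟨a, ha⟩)

lemma mul_unit_of_mem {x : C} {a : R} (ha : a ∈ A.E x) : a * (A.unit x : R) = a := by
  rw [mul_comm, A.unit_mul_of_mem ha]

lemma unit_mul_self (x : C) : (A.unit x : R) * A.unit x = A.unit x :=
  A.unit_mul_of_mem (A.unit x).2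

lemma app_mem {x y : C} (g : x ⟶ y) (r : R) : A.app g r ∈ A.E y := (A.β g _).2

lemma app_mul_unit {x y : C} (g : x ⟶ y) (r : R) : A.app g r * A.unit y = A.app g r :=
  A.mul_unit_of_mem (A.app_mem g r)

lemma app_eq {x y : C} (g : x ⟶ y) (r : R) (a : A.E x) (h : r * A.unit x = a) :
    A.app g r = A.β g a := by
  have : r • A.unit x = a := Subtype.ext h
  rw [app, this]

lemma β_mul_coe {x y : C} (g : x ⟶ y) (a b : A.E x) :
    ((A.β g (a * b) : A.E y) : R) = A.β g a * A.β g b := by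
  rw [A.β_mul]; rfl

lemma app_mul {x y : C} (g : x ⟶ y) (r s : R) : A.app g (r * s) = A.app g r * A.app g s := by
  rw [A.app_eq g (r * s) ((r • A.unit x) * (s • A.unit x)), β_mul_coe]
  · rfl
  · change r * s * A.unit x = (r * A.unit x) * (s * A.unit x)
    linear_combination -r * s * A.unit_mul_self x

lemma app_id (x : C) (r : R) : A.app (𝟙 x) r = r * A.unit x := by
  rw [app, A.β_id]; rfl

lemma app_app {x y z : C} (h : x ⟶ y) (g : y ⟶ z) (r : R) :
    A.app g (A.app h r) = A.app (h ≫ g) r := by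
  rw [A.app_eq g _ (A.β h (r • A.unit x)) (A.app_mul_unit h r), A.β_comp]; rfl

/-- `app` as a linear map. -/
def appLinear {x y : C} (g : x ⟶ y) : R →ₗ[K] R where
  toFun := A.app g
  map_add' r s := by
    rw [app, add_smul, map_add]; rfl
  map_smul' k r := by
    rw [app, smul_assoc, map_smul]; rfl

lemma app_sum {x y : C} (g : x ⟶ y) {ι : Type*} (s : Finset ι) (f : ι → R) :
    A.app g (∑ i ∈ s, f i) = ∑ i ∈ s, A.app g (f i) :=
  map_sum (A.appLinear g) f s

lemma app_zero {x y : C} (g : x ⟶ y) : A.app g 0 = 0 := map_zero (A.appLinear g)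

/-- The unit of `E y` is in the image of the multiplicative map `app g`, so `app g 1` fixes it. -/
lemma app_one {x y : C} (g : x ⟶ y) : A.app g 1 = A.unit y := by
  have h1 : A.app g (A.app (Groupoid.inv g) (A.unit y)) = A.unit y := by
    rw [app_app, Groupoid.inv_comp, app_id, unit_mul_self]
  have h2 : A.app g 1 * A.app g (A.app (Groupoid.inv g) (A.unit y)) =
      A.app g (A.app (Groupoid.inv g) (A.unit y)) := by
    rw [← app_mul, one_mul]
  rw [h1, app_mul_unit] at h2
  exact h2

lemma app_mul_unit_dom {x y : C} (g : x ⟶ y) (r : R) : A.app g (r * A.unit x) = A.app g r := by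
  have : A.app g (A.unit x) = A.unit y := by
    rw [← A.app_one g, ← one_mul (A.unit x : R), ← app_id, app_app, Category.id_comp]
  rw [app_mul, this, app_mul_unit]

lemma mem_invariants {H : Subgroupoid C} {r : R} :
    r ∈ A.invariants H ↔
      ∀ (x y : C) (h : x ⟶ y), h ∈ H.arrows x y → A.app h r = r * A.unit y := by
  constructor
  · intro hr x y h hh
    have h1 := congrArg Subtype.val (hr x y h hh (A.unit x))
    have h2 : ((A.β h (A.unit x) : A.E y) : R) = A.unit y := by
      rw [← A.app_one h, A.app_eq h 1 (A.unit x) (one_mul _)]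
    change A.app h r = r * (A.β h (A.unit x) : A.E y) at h1
    rw [h1, h2]
  · intro hr x y h hh a
    apply Subtype.ext
    have h1 : r • a = (r • A.unit x) * a := Subtype.ext <| by
      change r * (a : R) = (r * A.unit x) * a
      rw [mul_assoc, A.unit_mul_of_mem a.2]
    change ((A.β h (r • a) : A.E y) : R) = r * A.β h a
    rw [h1, β_mul_coe]
    change A.app h r * _ = _
    rw [hr x y h hh, mul_assoc, A.unit_mul_of_mem (A.β h a).2]

/-- The linear map `a ⊗ b ↦ a β_g (b 1_{g⁻¹})`. -/
noncomputable def pairing {x y : C} (g : x ⟶ y) : R ⊗[K] R →ₗ[K] R :=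
  LinearMap.mul' K R ∘ₗ TensorProduct.map LinearMap.id (A.appLinear g)

@[simp] lemma pairing_tmul {x y : C} (g : x ⟶ y) (a b : R) :
    A.pairing g (a ⊗ₜ[K] b) = a * A.app g b := rfl

lemma pairing_mul {x y : C} (g : x ⟶ y) (v w : R ⊗[K] R) :
    A.pairing g (v * w) = A.pairing g v * A.pairing g w := by
  induction v with
  | zero => simp
  | add v₁ v₂ h₁ h₂ => rw [add_mul, map_add, map_add, h₁, h₂, add_mul]
  | tmul a b =>
    induction w with
    | zero => simp
    | add w₁ w₂ h₁ h₂ => rw [mul_add, map_add, map_add, h₁, h₂, mul_add]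
    | tmul c d =>
      rw [Algebra.TensorProduct.tmul_mul_tmul, pairing_tmul, pairing_tmul, pairing_tmul, app_mul]
      ring

lemma pairing_mul_unit {x y : C} (g : x ⟶ y) (w : R ⊗[K] R) :
    A.pairing g w * A.unit y = A.pairing g w := by
  induction w with
  | zero => simp
  | add v w hv hw => rw [map_add, add_mul, hv, hw]
  | tmul a b => rw [pairing_tmul, mul_assoc, app_mul_unit]

lemma mem_fixingArrows_inv {T : Subalgebra K R} {x y : C} {g : x ⟶ y}
    (hg : g ∈ A.fixingArrows T x y) : Groupoid.inv g ∈ A.fixingArrows T y x := by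
  intro t ht
  rw [← app_mul_unit_dom, ← hg t ht, app_app, Groupoid.comp_inv, app_id]

/-- The subgroupoid `H_T` of arrows fixing `T`. -/
def fixingSubgroupoid (T : Subalgebra K R) : Subgroupoid C where
  arrows x y := A.fixingArrows T x y
  inv hg := A.mem_fixingArrows_inv hg
  mul := by
    intro x y z g hg h hh t ht
    rw [← app_app, hg t ht, app_mul_unit_dom, hh t ht]

lemma fixingSubgroupoid_isWide (T : Subalgebra K R) : (A.fixingSubgroupoid T).IsWide :=
  ⟨fun x t _ => A.app_id x t⟩

lemma le_invariants_fixingSubgroupoid (T : Subalgebra K R) :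
    T ≤ A.invariants (A.fixingSubgroupoid T) := fun t ht =>
  A.mem_invariants.2 fun _ _ _ hh => hh t ht

end Basic

/-! ### The units as orthogonal idempotents with sum one. -/

section Sum

variable {C : Type u} [Groupoid.{v} C] {K R : Type*} [CommRing K] [CommRing R] [Algebra K R]
  {A : GroupoidAction C K R}

lemma unit_mul_unit_of_ne [DecidableEq C] (hsum : DirectSum.IsInternal A.E) {x y : C}
    (hxy : x ≠ y) : (A.unit x : R) * A.unit y = 0 := by
  have hd := hsum.submodule_iSupIndep.pairwiseDisjoint hxy
  have := (Submodule.disjoint_def.1 hd) ((A.unit x : R) * A.unit y)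
    (Ideal.mul_mem_right _ _ (A.unit x).2) (Ideal.mul_mem_left _ _ (A.unit y).2)
  exact this

lemma sum_unit [DecidableEq C] [Fintype C] (hsum : DirectSum.IsInternal A.E) :
    ∑ x, (A.unit x : R) = 1 := by
  have h1 : (1 : R) ∈ ⨆ x, A.E x := by
    rw [hsum.submodule_iSup_eq_top]; trivial
  refine Eq.trans ?_ (?_ : (∑ x, (A.unit x : R)) * 1 = 1)
  · rw [mul_one]
  · refine Submodule.iSup_induction A.E (motive := fun r => (∑ x, (A.unit x : R)) * r = r) h1
      ?_ (by simp) ?_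
    · intro y r hr
      rw [Finset.sum_mul, Finset.sum_eq_single y, A.unit_mul_of_mem hr]
      · intro x _ hx
        rw [← A.unit_mul_of_mem hr, ← mul_assoc, unit_mul_unit_of_ne hsum hx, zero_mul]
      · simp
    · intro r s hr hs
      rw [mul_add, hr, hs]

lemma app_mul_unit_of_ne [DecidableEq C] (hsum : DirectSum.IsInternal A.E) {x y z : C}
    (g : x ⟶ y) (r : R) (h : y ≠ z) : A.app g r * A.unit z = 0 := by
  rw [← app_mul_unit, mul_assoc, unit_mul_unit_of_ne hsum h, mul_zero]

end Sum

/-! ### Traces, and the coordinates they produce. -/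

section Trace

variable {C : Type u} [Groupoid.{v} C] {K R : Type*} [CommRing K] [CommRing R] [Algebra K R]
  {A : GroupoidAction C K R} [Fintype C] [∀ x y : C, Fintype (x ⟶ y)]

lemma trace_add (H : Subgroupoid C) (r s : R) :
    A.trace H (r + s) = A.trace H r + A.trace H s := by
  simp only [trace, ← Finset.sum_add_distrib]
  refine Finset.sum_congr rfl fun x _ => Finset.sum_congr rfl fun y _ =>
    Finset.sum_congr rfl fun h _ => ?_
  split_ifs
  · exact map_add (A.appLinear h) r s
  · rw [add_zero]

lemma trace_mul {H : Subgroupoid C} {u : R} (hu : u ∈ A.invariants H) (r : R) :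
    A.trace H (u * r) = u * A.trace H r := by
  simp only [trace, Finset.mul_sum, mul_ite, mul_zero]
  refine Finset.sum_congr rfl fun x _ => Finset.sum_congr rfl fun y _ =>
    Finset.sum_congr rfl fun h _ => ?_
  split_ifs with hh
  · rw [app_mul, A.mem_invariants.1 hu x y h hh, mul_assoc, mul_comm (A.unit y : R),
      app_mul_unit]
  · rfl

open scoped Classical in
lemma trace_mul_unit [DecidableEq C] (hsum : DirectSum.IsInternal A.E) (H : Subgroupoid C)
    (r : R) (z : C) : A.trace H r * A.unit z =
      ∑ x : C, ∑ h : x ⟶ z, if h ∈ H.arrows x z then A.app h r else 0 := by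
  simp only [trace, Finset.sum_mul, ite_mul, zero_mul]
  refine Finset.sum_congr rfl fun x _ => ?_
  rw [Finset.sum_eq_single z]
  · simp only [app_mul_unit]
  · intro y _ hy
    refine Finset.sum_eq_zero fun h _ => ?_
    rw [app_mul_unit_of_ne hsum h r hy, ite_self]
  · simp

open scoped Classical in
lemma app_trace [DecidableEq C] (hsum : DirectSum.IsInternal A.E) (H : Subgroupoid C)
    {y z : C} (g : y ⟶ z) (r : R) : A.app g (A.trace H r) =
      ∑ x : C, ∑ h : x ⟶ y, if h ∈ H.arrows x y then A.app (h ≫ g) r else 0 := by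
  rw [← app_mul_unit_dom, trace_mul_unit hsum, app_sum]
  refine Finset.sum_congr rfl fun x _ => ?_
  rw [app_sum]
  refine Finset.sum_congr rfl fun h _ => ?_
  split_ifs
  · rw [app_app]
  · rw [app_zero]

lemma trace_mem [DecidableEq C] (hsum : DirectSum.IsInternal A.E) (H : Subgroupoid C) (r : R) :
    A.trace H r ∈ A.invariants H := by
  classical
  refine A.mem_invariants.2 fun y z g hg => ?_
  rw [app_trace hsum, trace_mul_unit hsum]
  refine Finset.sum_congr rfl fun x _ => ?_
  -- Composition with `g` permutes the arrows of `H`, so the trace is only reindexed.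
  refine Fintype.sum_equiv
    ⟨fun h => h ≫ g, fun h => h ≫ Groupoid.inv g, fun h => by simp, fun h => by simp⟩ _ _ ?_
  intro h
  have : h ≫ g ∈ H.arrows x z ↔ h ∈ H.arrows x y :=
    ⟨fun hh => by simpa using H.mul hh (H.inv hg), fun hh => H.mul hh hg⟩
  simp [this]

/-- Weighted by `t`, the pairing `a ⊗ b ↦ a tr(b t)` is the sum of all pairings `a β_g(b)`. -/
lemma exists_sum_pairing (t : R) :
    ∃ ψ : R ⊗[K] R →+ R, (∀ a b, ψ (a ⊗ₜ b) = a * A.trace ⊤ (b * t)) ∧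
      ∀ w, ψ w = ∑ x : C, ∑ y : C, ∑ g : x ⟶ y, A.pairing g w * A.app g t := by
  let ψ : R ⊗[K] R →+ R :=
    { toFun := fun w => ∑ x : C, ∑ y : C, ∑ g : x ⟶ y, A.pairing g w * A.app g t
      map_zero' := by simp
      map_add' := fun v w => by simp only [map_add, add_mul, Finset.sum_add_distrib] }
  refine ⟨ψ, fun a b => ?_, fun w => rfl⟩
  change ∑ x : C, ∑ y : C, ∑ g : x ⟶ y, A.pairing g (a ⊗ₜ b) * A.app g t = _
  simp only [trace, Finset.mul_sum, pairing_tmul, app_mul, mul_assoc]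
  refine Finset.sum_congr rfl fun x _ => Finset.sum_congr rfl fun y _ =>
    Finset.sum_congr rfl fun g _ => ?_
  have hg : g ∈ (⊤ : Subgroupoid C).arrows x y := trivial
  rw [if_pos hg]

variable [DecidableEq C] {m : ℕ} {r s : Fin m → R}

/-- After exchanging sums, the coordinates kill all arrows but the identities, which lie in `H` by
wideness. -/
lemma sum_mul_trace (hsum : DirectSum.IsInternal A.E)
    (h₁ : ∀ x : C, ∑ i, r i * A.app (𝟙 x) (s i) = A.unit x)
    (h₂ : ∀ (x : C) (g : x ⟶ x), g ≠ 𝟙 x → ∑ i, r i * A.app g (s i) = 0)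
    (h₃ : ∀ (x y : C) (g : x ⟶ y), x ≠ y → ∑ i, r i * A.app g (s i) = 0)
    {H : Subgroupoid C} (hH : H.IsWide) (t : R) : ∑ i, r i * A.trace H (s i * t) = t := by
  classical
  have key : ∑ i, r i * A.trace H (s i * t) = ∑ x : C, ∑ y : C, ∑ h : x ⟶ y,
      if h ∈ H.arrows x y then (∑ i, r i * A.app h (s i)) * A.app h t else 0 := by
    simp only [trace, Finset.mul_sum]
    rw [Finset.sum_comm]
    refine Finset.sum_congr rfl fun x _ => ?_
    rw [Finset.sum_comm]
    refine Finset.sum_congr rfl fun y _ => ?_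
    rw [Finset.sum_comm]
    refine Finset.sum_congr rfl fun h _ => ?_
    split_ifs
    · rw [Finset.sum_mul]
      exact Finset.sum_congr rfl fun i _ => by rw [app_mul, mul_assoc]
    · simp
  have ht : t = ∑ x : C, t * A.unit x := by rw [← Finset.mul_sum, sum_unit hsum, mul_one]
  rw [key]
  refine Eq.trans (Finset.sum_congr rfl fun x _ => ?_) ht.symm
  rw [Finset.sum_eq_single x]
  · rw [Finset.sum_eq_single (𝟙 x), if_pos (hH.wide x), h₁, app_id, mul_comm t, ← mul_assoc,
      unit_mul_self]
    · intro g _ hg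
      rw [h₂ x g hg, zero_mul, ite_self]
    · simp
  · intro y _ hy
    refine Finset.sum_eq_zero fun g _ => ?_
    rw [h₃ x y g hy.symm, zero_mul, ite_self]
  · simp

lemma exists_trace_eq_one (hsum : DirectSum.IsInternal A.E)
    (h₁ : ∀ x : C, ∑ i, r i * A.app (𝟙 x) (s i) = A.unit x)
    (h₂ : ∀ (x : C) (g : x ⟶ x), g ≠ 𝟙 x → ∑ i, r i * A.app g (s i) = 0)
    (h₃ : ∀ (x y : C) (g : x ⟶ y), x ≠ y → ∑ i, r i * A.app g (s i) = 0)
    {H : Subgroupoid C} (hH : H.IsWide) : ∃ c, A.trace H c = 1 := by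
  classical
  let tr : R →ₗ[A.invariants H] A.invariants H :=
    { toFun := fun t => ⟨A.trace H t, trace_mem hsum H t⟩
      map_add' := fun a b => Subtype.ext (trace_add H a b)
      map_smul' := fun u a => Subtype.ext (trace_mul u.2 a) }
  have hdual : ∀ t : R, ∑ i, tr (s i * t) • r i = t := fun t => by
    conv_rhs => rw [← sum_mul_trace hsum h₁ h₂ h₃ hH t]
    exact Finset.sum_congr rfl fun i _ => mul_comm _ _
  let I : Ideal (A.invariants H) := LinearMap.range tr
  have hfg : (⊤ : Submodule (A.invariants H) R).FG := by
    refine ⟨Finset.univ.image r, top_le_iff.1 fun t _ => ?_⟩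
    rw [← hdual t]
    exact Submodule.sum_mem _ fun i _ => Submodule.smul_mem _ _ (Submodule.subset_span (by simp))
  have hle : (⊤ : Submodule (A.invariants H) R) ≤ I • ⊤ := fun t _ => by
    rw [← hdual t]
    exact Submodule.sum_mem _ fun i _ => Submodule.smul_mem_smul ⟨_, rfl⟩ trivial
  -- The trace ideal `I` satisfies `I R = R`, so by Nakayama some `a ∈ 1 + I` annihilates `R`. As `1
  -- ∈ R`, `a = 0` and hence `1 ∈ I`.
  obtain ⟨a, ha, ha0⟩ :=
    Submodule.exists_sub_one_mem_and_smul_eq_zero_of_fg_of_le_smul I ⊤ hfg hle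
  have ha' : a = 0 := Subtype.ext <| by
    have : (a : R) * 1 = 0 := ha0 1 trivial
    simpa using this
  obtain ⟨c, hc⟩ := I.neg_mem ha
  refine ⟨c, ?_⟩
  have := congrArg Subtype.val hc
  simpa [ha', tr] using this

-- Expanding both traces over `h, k ∈ H` leaves terms `β_h (∑ r i * β_{h⁻¹gk} (s i))`, nonzero only
-- for `k = g⁻¹h`. This `k` lies in `H` exactly when `g` does, and the surviving terms add up to
-- `tr_H c` cut down to `E z`.
open scoped Classical in
lemma sum_trace_mul_app_trace (hsum : DirectSum.IsInternal A.E)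
    (h₁ : ∀ x : C, ∑ i, r i * A.app (𝟙 x) (s i) = A.unit x)
    (h₂ : ∀ (x : C) (g : x ⟶ x), g ≠ 𝟙 x → ∑ i, r i * A.app g (s i) = 0)
    (h₃ : ∀ (x y : C) (g : x ⟶ y), x ≠ y → ∑ i, r i * A.app g (s i) = 0)
    {H : Subgroupoid C} {c : R} (hc : A.trace H c = 1) {x z : C} (g : x ⟶ z) :
    ∑ i, A.trace H (c * r i) * A.app g (A.trace H (s i)) =
      if g ∈ H.arrows x z then (A.unit z : R) else 0 := by
  have inner : ∀ (v : C) (h : v ⟶ z), h ∈ H.arrows v z →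
      ∑ i, A.app h (c * r i) * A.app g (A.trace H (s i)) =
        if g ∈ H.arrows x z then A.app h c else 0 := by
    intro v h hh
    have e₁ : ∀ (w : C) (k : w ⟶ x), ∑ i, A.app h (c * r i) * A.app (k ≫ g) (s i) =
        A.app h c * A.app h (∑ i, r i * A.app (k ≫ g ≫ Groupoid.inv h) (s i)) := by
      intro w k
      rw [app_sum, Finset.mul_sum]
      refine Finset.sum_congr rfl fun i _ => ?_
      rw [app_mul, app_mul, app_app, mul_assoc]
      simp
    have e₂ : ∑ i, A.app h (c * r i) * A.app g (A.trace H (s i)) = ∑ w : C, ∑ k : w ⟶ x,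
        if k ∈ H.arrows w x then
          A.app h c * A.app h (∑ i, r i * A.app (k ≫ g ≫ Groupoid.inv h) (s i)) else 0 := by
      simp only [app_trace hsum, Finset.mul_sum]
      rw [Finset.sum_comm]
      refine Finset.sum_congr rfl fun w _ => ?_
      rw [Finset.sum_comm]
      refine Finset.sum_congr rfl fun k _ => ?_
      split_ifs
      · rw [e₁]
      · simp
    rw [e₂, Finset.sum_eq_single v]
    · rw [Finset.sum_eq_single (h ≫ Groupoid.inv g)]
      · have e₃ : (h ≫ Groupoid.inv g) ≫ g ≫ Groupoid.inv h = 𝟙 v := by simp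
        have e₄ : h ≫ Groupoid.inv g ∈ H.arrows v x ↔ g ∈ H.arrows x z := by
          constructor
          · intro hk
            have := H.mul (H.inv hk) hh
            simpa using this
          · exact fun hg => H.mul hh (H.inv hg)
        rw [e₃, h₁, ← one_mul (A.unit v : R), app_mul_unit_dom, app_one, app_mul_unit]
        simp only [e₄]
      · intro k _ hk
        rw [h₂, app_zero, mul_zero, ite_self]
        intro hk'
        apply hk
        have := congrArg (fun q => q ≫ h ≫ Groupoid.inv g) hk'
        simpa using this
      · simp
    · intro w _ hw
      refine Finset.sum_eq_zero fun k _ => ?_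
      rw [h₃ _ _ _ hw, app_zero, mul_zero, ite_self]
    · simp
  have e₅ : ∑ i, A.trace H (c * r i) * A.app g (A.trace H (s i)) =
      ∑ v : C, ∑ h : v ⟶ z, if h ∈ H.arrows v z then
        ∑ i, A.app h (c * r i) * A.app g (A.trace H (s i)) else 0 := by
    have : ∀ i, A.trace H (c * r i) * A.app g (A.trace H (s i)) =
        (A.trace H (c * r i) * A.unit z) * A.app g (A.trace H (s i)) := fun i => by
      rw [mul_assoc, A.unit_mul_of_mem (A.app_mem g _)]
    simp only [this, trace_mul_unit hsum, Finset.sum_mul]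
    rw [Finset.sum_comm]
    refine Finset.sum_congr rfl fun v _ => ?_
    rw [Finset.sum_comm]
    refine Finset.sum_congr rfl fun h _ => ?_
    split_ifs
    · rfl
    · simp
  have e₆ : ∀ (v : C) (h : v ⟶ z), (if h ∈ H.arrows v z then
      ∑ i, A.app h (c * r i) * A.app g (A.trace H (s i)) else 0) =
      if g ∈ H.arrows x z then (if h ∈ H.arrows v z then A.app h c else 0) else 0 := by
    intro v h
    by_cases hh : h ∈ H.arrows v z
    · rw [if_pos hh, if_pos hh, inner v h hh]
    · simp [hh]
  simp only [e₅, e₆]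
  split_ifs
  · rw [← trace_mul_unit hsum, hc, one_mul]
  · simp

/-- In `b = ∑ tr (s i * b) * r i` the full traces lie in `K` and move across the tensor sign. So `w`
is rebuilt from the values `ψ i w`, which are combinations of its pairings. -/
lemma eq_zero_of_pairing_eq_zero (hsum : DirectSum.IsInternal A.E) (hinv : A.invariants ⊤ = ⊥)
    (h₁ : ∀ x : C, ∑ i, r i * A.app (𝟙 x) (s i) = A.unit x)
    (h₂ : ∀ (x : C) (g : x ⟶ x), g ≠ 𝟙 x → ∑ i, r i * A.app g (s i) = 0)
    (h₃ : ∀ (x y : C) (g : x ⟶ y), x ≠ y → ∑ i, r i * A.app g (s i) = 0)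
    (w : R ⊗[K] R) (hw : ∀ (x y : C) (g : x ⟶ y), A.pairing g w = 0) : w = 0 := by
  choose ψ hψ hψ' using fun i => exists_sum_pairing (A := A) (s i)
  have key : ∀ v : R ⊗[K] R, v = ∑ i, ψ i v ⊗ₜ[K] r i := by
    intro v
    induction v with
    | zero => simp
    | add v₁ v₂ e₁ e₂ =>
      simp only [map_add, TensorProduct.add_tmul, Finset.sum_add_distrib]
      rw [← e₁, ← e₂]
    | tmul a b =>
      have hk : ∀ i, ∃ k : K, algebraMap K R k = A.trace ⊤ (s i * b) := fun i => by
        have := trace_mem hsum ⊤ (s i * b)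
        rwa [hinv] at this
      choose k hk using hk
      have e : b = ∑ i, k i • r i := by
        conv_lhs => rw [← sum_mul_trace hsum h₁ h₂ h₃ (H := ⊤) ⟨fun x => trivial⟩ b]
        exact Finset.sum_congr rfl fun i _ => by rw [← hk, Algebra.smul_def, mul_comm]
      conv_lhs => rw [e]
      rw [TensorProduct.tmul_sum]
      refine Finset.sum_congr rfl fun i _ => ?_
      rw [hψ, mul_comm b, ← hk, mul_comm a, ← Algebra.smul_def, TensorProduct.smul_tmul]
  rw [key w]
  refine Finset.sum_eq_zero fun i _ => ?_
  simp [hψ', hw]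

end Trace

end GroupoidAction

/-! ### Separability by means of a separability element. -/

section Separable

variable {K T : Type*} [CommRing K] [CommRing T] [Algebra K T]

/-- The tensor is the image of `1` under a `T ⊗ T`-linear section of multiplication. -/
lemma IsSeparableAlgebra.exists_tensor (h : IsSeparableAlgebra K T) :
    ∃ e : T ⊗[K] T, Algebra.TensorProduct.lmul' K (S := T) e = 1 ∧
      ∀ a b : T ⊗[K] T, Algebra.TensorProduct.lmul' K (S := T) a =
        Algebra.TensorProduct.lmul' K (S := T) b → a * e = b * e := by
  let : Module (T ⊗[K] T) T :=
    Module.compHom T (Algebra.TensorProduct.lmul' K (S := T)).toRingHom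
  have : Module.Projective (T ⊗[K] T) T := h
  let μ : T ⊗[K] T →ₗ[T ⊗[K] T] T :=
    { toFun := Algebra.TensorProduct.lmul' K (S := T)
      map_add' := map_add _
      map_smul' := fun a b => map_mul _ a b }
  have hμ : Function.Surjective μ := fun t => ⟨t ⊗ₜ 1, by
    change Algebra.TensorProduct.lmul' K (S := T) (t ⊗ₜ 1) = t
    simp⟩
  obtain ⟨σ, hσ⟩ := Module.projective_lifting_property μ LinearMap.id hμ
  have hs : ∀ a : T ⊗[K] T, a * σ 1 = σ (Algebra.TensorProduct.lmul' K (S := T) a) := fun a => by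
    have : a • (1 : T) = Algebra.TensorProduct.lmul' K (S := T) a := mul_one _
    rw [← this, map_smul, smul_eq_mul]
  exact ⟨σ 1, LinearMap.congr_fun hσ 1, fun a b hab => by rw [hs, hs, hab]⟩

lemma IsSeparableAlgebra.of_tensor (e : T ⊗[K] T)
    (h₁ : Algebra.TensorProduct.lmul' K (S := T) e = 1)
    (h₂ : ∀ t : T, (t ⊗ₜ[K] (1 : T)) * e = ((1 : T) ⊗ₜ[K] t) * e) : IsSeparableAlgebra K T := by
  let : Module (T ⊗[K] T) T :=
    Module.compHom T (Algebra.TensorProduct.lmul' K (S := T)).toRingHom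
  let μ : T ⊗[K] T →ₗ[T ⊗[K] T] T :=
    { toFun := Algebra.TensorProduct.lmul' K (S := T)
      map_add' := map_add _
      map_smul' := fun a b => map_mul _ a b }
  have key : ∀ a : T ⊗[K] T,
      ((Algebra.TensorProduct.lmul' K (S := T) a) ⊗ₜ[K] (1 : T)) * e = a * e := by
    intro a
    induction a with
    | zero => simp
    | add a b ha hb => rw [map_add, TensorProduct.add_tmul, add_mul, ha, hb, add_mul]
    | tmul a b =>
      have e₁ : a ⊗ₜ[K] b = (a ⊗ₜ[K] (1 : T)) * ((1 : T) ⊗ₜ[K] b) := by simp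
      have e₂ : (a * b) ⊗ₜ[K] (1 : T) = (a ⊗ₜ[K] (1 : T)) * (b ⊗ₜ[K] (1 : T)) := by simp
      rw [Algebra.TensorProduct.lmul'_apply_tmul, e₁, e₂, mul_assoc, mul_assoc, h₂]
  let σ : T →ₗ[T ⊗[K] T] T ⊗[K] T :=
    { toFun := fun t => (t ⊗ₜ[K] (1 : T)) * e
      map_add' := fun a b => by rw [TensorProduct.add_tmul, add_mul]
      map_smul' := fun a t => by
        have e₁ : a • t = Algebra.TensorProduct.lmul' K (S := T) (a * (t ⊗ₜ[K] (1 : T))) := by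
          rw [map_mul, Algebra.TensorProduct.lmul'_apply_tmul, mul_one]; rfl
        rw [e₁, key, mul_assoc]; rfl }
  change Module.Projective (T ⊗[K] T) T
  refine Module.Projective.of_split σ μ (LinearMap.ext fun t => ?_)
  change Algebra.TensorProduct.lmul' K (S := T) ((t ⊗ₜ[K] (1 : T)) * e) = t
  rw [map_mul, h₁, Algebra.TensorProduct.lmul'_apply_tmul, mul_one, mul_one]

end Separable

namespace GroupoidAction

/-! ### The two directions of the correspondence. -/

section Correspondence

variable {C : Type u} [Groupoid.{v} C] [Fintype C] [∀ x y : C, Fintype (x ⟶ y)] [DecidableEq C]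
  {K R : Type*} [CommRing K] [CommRing R] [Algebra K R] {A : GroupoidAction C K R}

open scoped Classical in
lemma IsGalois.exists_invariants_coordinates (hgal : A.IsGalois)
    (hsum : DirectSum.IsInternal A.E) {H : Subgroupoid C} (hH : H.IsWide) :
    ∃ (m : ℕ) (a b : Fin m → A.invariants H), ∀ (x y : C) (g : x ⟶ y),
      ∑ i, (a i : R) * A.app g (b i) = if g ∈ H.arrows x y then (A.unit y : R) else 0 := by
  obtain ⟨m, r, s, h₁, h₂, h₃⟩ := hgal
  obtain ⟨c, hc⟩ := exists_trace_eq_one hsum h₁ h₂ h₃ hH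
  exact ⟨m, fun i => ⟨_, trace_mem hsum H (c * r i)⟩, fun i => ⟨_, trace_mem hsum H (s i)⟩,
    fun x y g => sum_trace_mul_app_trace hsum h₁ h₂ h₃ hc g⟩

/-- Since `β_g` and `β_h` agree on `b i` after multiplication by `e`, `e = ∑ β_g (a i) β_g (b i) e =
β_g (∑ a i * β_{g⁻¹h} (b i)) e`, and the inner sum vanishes because `g⁻¹h ∉ H`. -/
lemma IsGalois.eq_zero_of_forall_app_mul_eq (hgal : A.IsGalois)
    (hsum : DirectSum.IsInternal A.E) {H : Subgroupoid C} (hH : H.IsWide) {x y z : C}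
    (g : x ⟶ z) (h : y ⟶ z) (hgh : h ≫ Groupoid.inv g ∉ H.arrows y x) {e : R}
    (he : e ∈ A.E z) (heq : ∀ t ∈ A.invariants H, A.app g t * e = A.app h t * e) : e = 0 := by
  classical
  obtain ⟨m, a, b, hab⟩ := hgal.exists_invariants_coordinates hsum hH
  have e₁ : ∑ i, A.app g (a i) * A.app h (b i) = 0 := by
    have := congrArg (A.app g) ((hab y x (h ≫ Groupoid.inv g)).trans (if_neg hgh))
    rw [app_zero, app_sum] at this
    rw [← this]
    refine Finset.sum_congr rfl fun i _ => ?_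
    rw [app_mul, app_app]
    simp
  have e₂ : ∑ i, A.app g (a i) * A.app g (b i) = A.unit z := by
    have := congrArg (A.app g) ((hab x x (𝟙 x)).trans (if_pos (hH.wide x)))
    rw [← one_mul (A.unit x : R), app_mul_unit_dom, app_one, app_sum] at this
    rw [← this]
    refine Finset.sum_congr rfl fun i _ => ?_
    rw [app_mul, app_app]
    simp
  rw [← A.unit_mul_of_mem he, ← e₂, Finset.sum_mul, ← zero_mul e, ← e₁, Finset.sum_mul]
  refine Finset.sum_congr rfl fun i _ => ?_
  rw [mul_assoc, heq _ (b i).2, mul_assoc]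

lemma IsGalois.fixingSubgroupoid_invariants (hgal : A.IsGalois)
    (hsum : DirectSum.IsInternal A.E) (hne : ∀ x, (A.unit x : R) ≠ 0) {H : Subgroupoid C}
    (hH : H.IsWide) : A.fixingSubgroupoid (A.invariants H) = H := by
  ext x y g
  constructor
  · intro hg
    by_contra hgH
    refine hne y (hgal.eq_zero_of_forall_app_mul_eq hsum hH (𝟙 y) g ?_ (A.unit y).2 ?_)
    · simpa using hgH
    · intro t ht
      rw [app_id, hg t ht]
  · exact fun hg t ht => A.mem_invariants.1 ht x y g hg

lemma IsGalois.isStrong_invariants (hgal : A.IsGalois) (hsum : DirectSum.IsInternal A.E)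
    {H : Subgroupoid C} (hH : H.IsWide) : A.IsStrong (A.invariants H) := by
  intro x y z g h hgh e he _ he0
  by_contra! hcon
  exact he0 (hgal.eq_zero_of_forall_app_mul_eq hsum hH g h
    (fun hk => hgh fun t ht => A.mem_invariants.1 ht _ _ _ hk) he hcon)

lemma IsGalois.isSeparableAlgebra_invariants (hgal : A.IsGalois)
    (hsum : DirectSum.IsInternal A.E) (hinv : A.invariants ⊤ = ⊥) {H : Subgroupoid C}
    (hH : H.IsWide) : IsSeparableAlgebra K (A.invariants H) := by
  classical
  obtain ⟨m, a, b, hab⟩ := hgal.exists_invariants_coordinates hsum hH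
  obtain ⟨n, r, s, h₁, h₂, h₃⟩ := hgal
  obtain ⟨c, hc⟩ := exists_trace_eq_one hsum h₁ h₂ h₃ hH
  let ι : A.invariants H →ₗ[K] R := (A.invariants H).val.toLinearMap
  let p : R →ₗ[K] A.invariants H :=
    { toFun := fun t => ⟨A.trace H (t * c), trace_mem hsum H _⟩
      map_add' := fun u v => Subtype.ext <| by
        change A.trace H ((u + v) * c) = _
        rw [add_mul, trace_add]; rfl
      map_smul' := fun k u => Subtype.ext <| by
        change A.trace H ((k • u) * c) = k • A.trace H (u * c)
        rw [Algebra.smul_def, Algebra.smul_def, mul_assoc,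
          trace_mul ((A.invariants H).algebraMap_mem k)] }
  have hp : p ∘ₗ ι = LinearMap.id := LinearMap.ext fun t => Subtype.ext <| by
    change A.trace H (t * c) = t
    rw [trace_mul t.2, hc, mul_one]
  -- The weighted trace `p` retracts the inclusion `K`-linearly, so identities in the tensor square
  -- of `R^H` can be tested in `R ⊗ R`, where the pairings separate points.
  have hinj : Function.Injective (TensorProduct.map ι ι) := by
    refine Function.LeftInverse.injective (g := TensorProduct.map p p) fun w => ?_
    rw [← LinearMap.comp_apply, ← TensorProduct.map_comp, hp, TensorProduct.map_id]; rfl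
  refine IsSeparableAlgebra.of_tensor (∑ i, a i ⊗ₜ[K] b i) ?_ fun t => ?_
  · rw [map_sum]
    simp only [Algebra.TensorProduct.lmul'_apply_tmul]
    apply Subtype.ext
    rw [AddSubmonoidClass.coe_finsetSum]
    have hx : ∀ x : C, (∑ i, (a i : R) * b i) * A.unit x = A.unit x := fun x => by
      rw [← (hab x x (𝟙 x)).trans (if_pos (hH.wide x)), Finset.sum_mul]
      have hu := (hab x x (𝟙 x)).trans (if_pos (hH.wide x))
      refine Finset.sum_congr rfl fun i _ => ?_
      rw [hu, app_id, mul_assoc]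
    change ∑ i, (a i : R) * b i = 1
    rw [← mul_one (∑ i, (a i : R) * b i), ← sum_unit hsum, Finset.mul_sum]
    exact Finset.sum_congr rfl fun x _ => hx x
  · apply hinj
    rw [← sub_eq_zero, ← map_sub]
    refine eq_zero_of_pairing_eq_zero hsum hinv h₁ h₂ h₃ _ fun x y g => ?_
    rw [map_sub, map_sub, sub_eq_zero]
    simp only [Finset.mul_sum, Algebra.TensorProduct.tmul_mul_tmul, map_sum,
      TensorProduct.map_tmul, pairing_tmul, one_mul]
    change ∑ i, ((t : R) * a i) * A.app g (b i) = ∑ i, (a i : R) * A.app g ((t : R) * b i)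
    have e₁ : ∑ i, ((t : R) * a i) * A.app g (b i) = t * ∑ i, (a i : R) * A.app g (b i) := by
      rw [Finset.mul_sum]
      exact Finset.sum_congr rfl fun i _ => mul_assoc _ _ _
    have e₂ : ∑ i, (a i : R) * A.app g ((t : R) * b i) =
        A.app g t * ∑ i, (a i : R) * A.app g (b i) := by
      rw [Finset.mul_sum]
      exact Finset.sum_congr rfl fun i _ => by rw [app_mul, mul_left_comm]
    rw [e₁, e₂, hab]
    split_ifs with hg
    · rw [A.mem_invariants.1 t.2 x y g hg, mul_assoc, unit_mul_self]
    · simp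

lemma IsGalois.invariants_fixingSubgroupoid (hgal : A.IsGalois)
    (hsum : DirectSum.IsInternal A.E) (hinv : A.invariants ⊤ = ⊥) {T : Subalgebra K R}
    (hsep : IsSeparableAlgebra K T) (hstr : A.IsStrong T) :
    A.invariants (A.fixingSubgroupoid T) = T := by
  classical
  refine le_antisymm (fun u hu => ?_) (A.le_invariants_fixingSubgroupoid T)
  obtain ⟨e, he₁, he₂⟩ := hsep.exists_tensor
  let j : T ⊗[K] T →ₐ[K] R ⊗[K] R := Algebra.TensorProduct.map T.val T.val
  have hidem : e * e = e := by
    have := he₂ e 1 (by rw [he₁, map_one])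
    rwa [one_mul] at this
  have hpair : ∀ (x y : C) (g : x ⟶ y), A.pairing g (j e) =
      if g ∈ (A.fixingSubgroupoid T).arrows x y then (A.unit y : R) else 0 := by
    intro x y g
    split_ifs with hg
    · have : ∀ w : T ⊗[K] T, A.pairing g (j w) =
          (Algebra.TensorProduct.lmul' K (S := T) w : R) * A.unit y := by
        intro w
        induction w with
        | zero => simp
        | add v w hv hw => rw [map_add, map_add, map_add, hv, hw, Subalgebra.coe_add, add_mul]
        | tmul a b =>
          change (a : R) * A.app g b = (a : R) * b * A.unit y
          rw [hg b b.2, mul_assoc]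
      rw [this, he₁, OneMemClass.coe_one, one_mul]
    · by_contra hne
      -- The pairing of `e` with `g` is itself an idempotent of `E y`. If nonzero it would be a test
      -- idempotent for strongness, yet `(1 ⊗ t) e = (t ⊗ 1) e` says that `g` and `𝟙 y` agree on it.
      obtain ⟨t, ht, htne⟩ := hstr x y y g (𝟙 y)
        (fun hk => hg (by
          have hk' := A.mem_fixingArrows_inv hk
          simp only [Category.id_comp, Groupoid.inv_eq_inv, IsIso.inv_inv] at hk'
          exact hk')) (A.pairing g (j e))
        (by rw [← pairing_mul_unit]; exact Ideal.mul_mem_left _ _ (A.unit y).2)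
        (by rw [IsIdempotentElem, ← pairing_mul, ← map_mul, hidem]) hne
      apply htne
      have h := congrArg (fun w => A.pairing g (j w))
        (he₂ ((1 : T) ⊗ₜ (⟨t, ht⟩ : T)) ((⟨t, ht⟩ : T) ⊗ₜ (1 : T)) (by simp))
      simp only [map_mul, pairing_mul] at h
      have e₁ : A.pairing g (j ((1 : T) ⊗ₜ (⟨t, ht⟩ : T))) = A.app g t := one_mul _
      have e₂ : A.pairing g (j ((⟨t, ht⟩ : T) ⊗ₜ (1 : T))) = t * A.unit y := by
        change t * A.app g 1 = _
        rw [app_one]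
      rw [e₁, e₂] at h
      rw [h, app_id]
  obtain ⟨m, r, s, h₁, h₂, h₃⟩ := hgal
  obtain ⟨c, hc⟩ := exists_trace_eq_one hsum h₁ h₂ h₃ (A.fixingSubgroupoid_isWide T)
  obtain ⟨ψ, hψ, hψ'⟩ := exists_sum_pairing (A := A) (u * c)
  -- By `hpair` only arrows of `H_T` survive, leaving `tr (u * c) = u * tr c = u` along `H_T`.
  have hu' : ψ (j e) = u := by
    refine (hψ' (j e)).trans (Eq.trans ?_ ((trace_mul hu c).trans (by rw [hc, mul_one])))
    rw [trace]
    refine Finset.sum_congr rfl fun x _ => Finset.sum_congr rfl fun y _ =>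
      Finset.sum_congr rfl fun g _ => ?_
    rw [hpair]
    split_ifs
    · rw [A.unit_mul_of_mem (A.app_mem g _)]
    · rw [zero_mul]
  have hmem : ∀ w : T ⊗[K] T, ψ (j w) ∈ T := by
    intro w
    induction w with
    | zero => simp
    | add v w hv hw => rw [map_add, map_add]; exact T.add_mem hv hw
    | tmul a b =>
      have : A.trace ⊤ ((b : R) * (u * c)) ∈ T := by
        have h := trace_mem hsum ⊤ ((b : R) * (u * c))
        rw [hinv] at h
        exact bot_le (a := T) h
      change ψ ((a : R) ⊗ₜ (b : R)) ∈ T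
      rw [hψ]
      exact T.mul_mem a.2 this
  rw [← hu']
  exact hmem e

end Correspondence

end GroupoidAction

theorem theorem5p5 {C : Type u} [Groupoid.{v} C] [DecidableEq C] [Nonempty C] [Finite C]
    [∀ x y : C, Finite (x ⟶ y)] {K R : Type*} [CommRing K] [Nontrivial K] [CommRing R]
    [Algebra K R] [FaithfulSMul K R] (A : GroupoidAction C K R)
    (hsum : DirectSum.IsInternal A.E) (hinv : A.invariants ⊤ = ⊥) (hgal : A.IsGalois)
    (hproj : ∀ x : C, IsFaithfullyProjective K (A.E x)) :
    Set.BijOn (fun H : Subgroupoid C => A.invariants H) {H | H.IsWide}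
      {T : Subalgebra K R | IsSeparableAlgebra K T ∧ A.IsStrong T} := by
  cases nonempty_fintype C
  let : ∀ x y : C, Fintype (x ⟶ y) := fun x y => Fintype.ofFinite _
  -- A zero unit would make `E x` zero, on which `0` and `1` of `K` act alike, against faithfulness.
  have hne : ∀ x, (A.unit x : R) ≠ 0 := fun x h => by
    have := (hproj x).1
    refine one_ne_zero (α := K) (FaithfulSMul.eq_of_smul_eq_smul (α := A.E x) fun a => ?_)
    have ha : a = 0 := Subtype.ext <| by rw [← A.unit_mul_of_mem a.2, h, zero_mul]; rfl
    rw [ha, smul_zero, smul_zero]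
  refine ⟨fun H hH => ⟨hgal.isSeparableAlgebra_invariants hsum hinv hH,
    hgal.isStrong_invariants hsum hH⟩, fun H hH H' hH' h => ?_, fun T hT => ?_⟩
  · change A.invariants H = A.invariants H' at h
    rw [← hgal.fixingSubgroupoid_invariants hsum hne hH, h,
      hgal.fixingSubgroupoid_invariants hsum hne hH']
  · exact ⟨A.fixingSubgroupoid T, A.fixingSubgroupoid_isWide T,
      hgal.invariants_fixingSubgroupoid hsum hinv hT.1 hT.2⟩
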